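/- For $n\ge 0$ let $B_n$ be the hyperoctahedral group, i.e. the group of permutations $\pi$ of $\{-n,\dots,-1,1,\dots,n\}$ with $\pi(-j)=-\pi(j)$ for all $j$. For $\pi\in B_n$ and $1\le p\le n$ write $\pi(p)=(-1)^{r_p}\sigma_p$ with $\sigma_p=|\pi(p)|$ and $r_p\in\{0,1\}$. For $1\le i\le n$ put $p=n+1-i$ and $$\mathrm{inv}_i(\pi)=\begin{cases}|\{j<p:\sigma_j>\sigma_p\}| & \text{if } r_p=0,\\ 1+2\,|\{j<p:\sigma_j<\sigma_p\}|+|\{j<p:\sigma_j>\sigma_p\}| & \text{if } r_p=1,\end{cases}$$ where $j$ ranges over $\{1,\dots,n\}$, and let $\mathrm{inv}_B(\pi)=\sum_{i=1}^n \mathrm{inv}_i(\pi)$ be the number of inversions of type $B$ of $\pi$. Let $i_B(n,k)=|\{\pi\in B_n:\mathrm{inv}_B(\pi)=k\}|$ be the Mahonian numbers of type $B$, and let $$T_0(x)=\sum_{n\ge 0} i_B(n,n)\,x^n .$$ Let $C(x)=\frac{1-\sqrt{1-4x}}{2x}=\sum_{n\ge0}\frac{1}{n+1}\binom{2n}{n}x^n$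 be the generating function of the Catalan numbers, and let $L(x)=\frac{1-x}{1-2x}\prod_{n\ge 1}(1-x^{2n})$. Then, as formal power series in $x$, $$T_0(x)=L\bigl(xC(x)\bigr).$$ -/

import Mathlib

namespace MahonianB

/-- The set `⟨n⟩ = {-n, …, -1, 1, …, n}`. -/
abbrev SignedInterval (n : ℕ) : Type := {z : ℤ // z ≠ 0 ∧ |z| ≤ (n : ℤ)}

/-- The negation `j ↦ -j` of `⟨n⟩`. -/
instance (n : ℕ) : Neg (SignedInterval n) :=
  ⟨fun z => ⟨-z.1, neg_ne_zero.mpr z.2.1, by rw [abs_neg]; exact z.2.2⟩⟩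

/-- The hyperoctahedral group `B_n`: the permutations `π` of `⟨n⟩` with `π (-j) = -π j`. (It is
equivalent to ask this for all `j ∈ ⟨n⟩` or for `j ∈ [n]` only.) -/
def hyperoctahedralGroup (n : ℕ) : Subgroup (Equiv.Perm (SignedInterval n)) where
  carrier := {π | ∀ j, π (-j) = -π j}
  mul_mem' := by
    intro a b ha hb j
    rw [Equiv.Perm.mul_apply, Equiv.Perm.mul_apply, hb, ha]
  one_mem' := by
    intro j
    rfl
  inv_mem' := by
    intro a ha j
    rw [Equiv.Perm.inv_eq_iff_eq, ha]
    exact congrArg Neg.neg (Equiv.apply_symm_apply a j).symm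

/-- The element `p + 1 ∈ [n] ⊆ ⟨n⟩`. The positions `1, …, n` of the one-line notation of a signed
permutation are indexed by `p : Fin n`, position `p + 1` corresponding to `p`. -/
def position {n : ℕ} (p : Fin n) : SignedInterval n :=
  ⟨(p : ℤ) + 1, by omega, by rw [abs_of_nonneg (by omega)]; have := p.isLt; omega⟩

/-- The one-line notation of a signed permutation is
`((-1)^{r_1} σ_1, …, (-1)^{r_n} σ_n)` with `σ ∈ S_n` and `r_j ∈ {0, 1}`; this is the entry
`σ_{p+1} = |π(p+1)|`. -/
def absEntry {n : ℕ} (π : hyperoctahedralGroup n) (p : Fin n) : ℕ :=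
  ((π.1 (position p)).1).natAbs

/-- `r_{p+1} = 1`, that is, the entry `π(p+1)` is negative. -/
def IsNegative {n : ℕ} (π : hyperoctahedralGroup n) (p : Fin n) : Prop :=
  (π.1 (position p)).1 < 0

instance {n : ℕ} (π : hyperoctahedralGroup n) (p : Fin n) : Decidable (IsNegative π p) :=
  inferInstanceAs (Decidable (_ < _))

/-- The number of earlier positions `j < p` with `σ_j > σ_p`. -/
def greaterBefore {n : ℕ} (π : hyperoctahedralGroup n) (p : Fin n) : ℕ :=
  (Finset.univ.filter fun j : Fin n => j < p ∧ absEntry π p < absEntry π j).card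

/-- The number of earlier positions `j < p` with `σ_j < σ_p`. -/
def smallerBefore {n : ℕ} (π : hyperoctahedralGroup n) (p : Fin n) : ℕ :=
  (Finset.univ.filter fun j : Fin n => j < p ∧ absEntry π j < absEntry π p).card

/-- The number of `i`-inversions of `π`, `1 ≤ i ≤ n`, where `i` is one more than the argument in
`Fin n`. It is read off at the position `n + 1 - i`, which is `i.rev` in the indexing by `Fin n`. -/
def inversionsAt {n : ℕ} (π : hyperoctahedralGroup n) (i : Fin n) : ℕ :=
  if IsNegative π i.rev then 1 + 2 * smallerBefore π i.rev + greaterBefore π i.rev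
  else greaterBefore π i.rev

/-- The number of inversions of type `B` of `π`. -/
def invB {n : ℕ} (π : hyperoctahedralGroup n) : ℕ :=
  ∑ i : Fin n, inversionsAt π i

/-- The Mahonian number `i_B(n, k)` of type `B`: the number of `π ∈ B_n` with exactly `k`
inversions of type `B`. It is defined for every integer `k`, and is `0` when `k < 0`. -/
noncomputable def mahonianB (n : ℕ) (k : ℤ) : ℕ :=
  Nat.card {π : hyperoctahedralGroup n // (invB π : ℤ) = k}

open PowerSeries

/-- `T_j(x) = ∑_{n ≥ 0} i_B(n, n - j) x^n`. -/
noncomputable def T (j : ℕ) : PowerSeries ℚ :=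
  PowerSeries.mk fun n => (mahonianB n ((n : ℤ) - (j : ℤ)) : ℚ)

/-- The generating function `C(x) = ∑_{n ≥ 0} C_n x^n` of the Catalan numbers. -/
noncomputable def catalanGF : PowerSeries ℚ :=
  PowerSeries.mk fun n => (catalan n : ℚ)

section

open scoped PowerSeries.WithPiTopology

/-- The infinite product below converges coefficientwise (over any choice of order, in fact). -/
theorem multipliable_one_sub_X_pow_two_mul :
    Multipliable fun n : ℕ => (1 : PowerSeries ℚ) - X ^ (2 * (n + 1)) := by
  have h : Filter.Tendsto (fun n : ℕ => (-(X : PowerSeries ℚ) ^ (2 * (n + 1))).order)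
      Filter.atTop (nhds ⊤) := by
    refine ENat.tendsto_nhds_top_iff_natCast_lt.mpr fun n => Filter.eventually_atTop.mpr ⟨n, ?_⟩
    intro m hm
    rw [PowerSeries.order_neg, PowerSeries.order_X_pow]
    exact_mod_cast (by omega : n < 2 * (m + 1))
  simpa [sub_eq_add_neg] using
    PowerSeries.WithPiTopology.multipliable_one_add_of_tendsto_order_atTop_nhds_top ℚ h

/-- `L(x) = (1 - x) / (1 - 2x) · ∏_{n ≥ 1} (1 - x^{2n})` in `ℚ⟦x⟧`; the infinite product is the
coefficientwise limit of its partial products. -/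
noncomputable def L : PowerSeries ℚ :=
  (1 - X) * (1 - 2 * X)⁻¹ * ∏' n : ℕ, (1 - X ^ (2 * (n + 1)))

end

/-- `x C(x)` has no constant term, so that it can be substituted into any power series. -/
theorem hasSubst_X_mul_catalanGF : PowerSeries.HasSubst (X * catalanGF) :=
  PowerSeries.HasSubst.of_constantCoeff_zero' (by simp)

end MahonianB

namespace MahonianB

open PowerSeries

/-! A signed permutation is encoded by its inversion numbers: the one read at position i takes any
of 2i values, independently of the others (`inversionCode_bijective`). Hence i_B(n,n) is the
coefficient of x^n in ∏_{i≤n} (1-x^{2i})/(1-x). Factors with i > n do not affect it, so T_0 =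
`diagonal` P with P = ∏_{i≥1} (1-x^{2i}). Lagrange inversion for w = xC(x), where w(1-w) = x,
evaluates this diagonal (`diagonal_eq_subst`). -/

/-! ### Lagrange inversion -/

/-- The series `∑_{n ≥ 0} [x^n] (F(x) (1 - x)^{-n}) x^n`. -/
noncomputable def diagonal (F : PowerSeries ℚ) : PowerSeries ℚ :=
  PowerSeries.mk fun n => coeff n (F * (PowerSeries.mk 1) ^ n)

theorem diagonal_add (F G : PowerSeries ℚ) : diagonal (F + G) = diagonal F + diagonal G := by
  ext n
  simp [diagonal, add_mul]

theorem diagonal_C_mul (a : ℚ) (F : PowerSeries ℚ) :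
    diagonal (C a * F) = C a * diagonal F := by
  ext n
  simp [diagonal, mul_assoc]

/-- The factor 1 - X cancels one power of 1/(1 - X), and X shifts the degree; together they pass
from index n + 1 to n. -/
theorem diagonal_X_mul_one_sub_X_mul (F : PowerSeries ℚ) :
    diagonal (X * (1 - X) * F) = X * diagonal F := by
  ext n
  cases n with
  | zero => simp [diagonal]
  | succ n =>
    have h : X * (1 - X) * F * (PowerSeries.mk 1 : PowerSeries ℚ) ^ (n + 1) =
        X * (F * PowerSeries.mk 1 ^ n) := by
      linear_combination X * F * PowerSeries.mk 1 ^ n * mk_one_mul_one_sub_eq_one ℚ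
    rw [coeff_succ_X_mul, diagonal, diagonal, coeff_mk, coeff_mk, h, coeff_succ_X_mul]

/-- For n ≥ 1 the coefficient is binom(2n,n) - 2 binom(2n-1,n-1) = 0. -/
theorem diagonal_one_sub_two_mul_X :
    diagonal ((1 - 2 * X) * PowerSeries.mk 1) = 1 := by
  ext n
  rw [diagonal, coeff_mk, mul_assoc, ← pow_succ', mk_one_pow_eq_mk_choose_add, sub_mul, one_mul,
    mul_assoc]
  cases n with
  | zero => simp
  | succ n =>
    have h2 : (2 : PowerSeries ℚ) = C 2 := (map_ofNat C 2).symm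
    rw [map_sub, h2, coeff_C_mul, coeff_succ_X_mul, coeff_mk, coeff_mk, coeff_one,
      if_neg n.succ_ne_zero, show n + 1 + (n + 1) = (n + 1 + n) + 1 by ring, Nat.choose_succ_succ,
      show n + 1 + n = n + (n + 1) by ring, Nat.choose_symm_add]
    push_cast
    ring

theorem X_mul_catalanGF_mul_one_sub :
    (X * catalanGF) * (1 - X * catalanGF) = X := by
  have h : catalanGF = PowerSeries.map (Nat.castRingHom ℚ) catalanSeries := by
    ext n
    simp [catalanGF]
  have h1 := congrArg (PowerSeries.map (Nat.castRingHom ℚ)) catalanSeries_sq_mul_X_add_one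
  rw [map_add, map_mul, map_pow, map_X, map_one, ← h] at h1
  linear_combination -X * h1

theorem one_sub_two_mul_X_mul_inv :
    (1 - 2 * X : PowerSeries ℚ) * (1 - 2 * X)⁻¹ = 1 :=
  PowerSeries.mul_inv_cancel _ (by simp)

/-- The Lagrange inversion formula for `w = x C(x)`, the solution of `w = x / (1 - w)`. -/
theorem diagonal_eq_subst (F : PowerSeries ℚ) :
    diagonal F = (F * ((1 - X) * (1 - 2 * X)⁻¹)).subst (X * catalanGF : PowerSeries ℚ) := by
  set S := substAlgHom (R := ℚ) hasSubst_X_mul_catalanGF with hS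
  set K : PowerSeries ℚ := (1 - X) * (1 - 2 * X)⁻¹ with hK
  have hSX : S X = X * catalanGF := substAlgHom_X hasSubst_X_mul_catalanGF
  -- Both sides are linear, turn a factor X(1 - X) into X, and send G = (1 - 2X)/(1 - X) to 1.
  -- Writing F = aG + X(1 - X)F' gains one power of X per induction step.
  suffices h : ∀ (k : ℕ) (F : PowerSeries ℚ), X ^ k ∣ diagonal F - S (F * K) by
    rw [← coe_substAlgHom hasSubst_X_mul_catalanGF, ← sub_eq_zero]
    ext n
    exact X_pow_dvd_iff.mp (h (n + 1) F) n n.lt_succ_self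
  intro k
  induction k with
  | zero => simp
  | succ k ih =>
    intro F
    set a := constantCoeff F
    set G : PowerSeries ℚ := (1 - 2 * X) * PowerSeries.mk 1 with hG
    have hU := mk_one_mul_one_sub_eq_one ℚ
    have hG0 : constantCoeff G = 1 := by
      have : constantCoeff (PowerSeries.mk 1 : PowerSeries ℚ) = 1 := by
        rw [← coeff_zero_eq_constantCoeff_apply, coeff_mk, Pi.one_apply]
      simp [hG, this]
    obtain ⟨H, hH⟩ : X ∣ F - C a * G := X_dvd_iff.mpr (by simp [hG0, a])
    have hF : F = C a * G + X * (1 - X) * (H * PowerSeries.mk 1) := by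
      linear_combination hH - X * H * hU
    have hGK : G * K = 1 := by
      rw [hG, hK]
      linear_combination (1 - 2 * X : PowerSeries ℚ) * (1 - 2 * X)⁻¹ * hU +
        one_sub_two_mul_X_mul_inv
    have hSF : S (F * K) = C a + X * S (H * PowerSeries.mk 1 * K) := by
      have : F * K = C a + X * (1 - X) * (H * PowerSeries.mk 1 * K) := by
        rw [hF]
        linear_combination C a * hGK
      rw [this, map_add, map_mul, map_mul S X, map_sub, hSX, map_one,
        X_mul_catalanGF_mul_one_sub]
      congr 1
      exact S.commutes a
    have hDF : diagonal F = C a + X * diagonal (H * PowerSeries.mk 1) := by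
      rw [hF, diagonal_add, diagonal_C_mul, diagonal_X_mul_one_sub_X_mul,
        diagonal_one_sub_two_mul_X, mul_one]
    rw [hSF, hDF, add_sub_add_left_eq_sub, ← mul_sub, pow_succ']
    exact mul_dvd_mul_left X (ih _)

/-! ### Truncating the infinite product -/

theorem X_pow_dvd_prod_sub_prod {m n : ℕ} (h : n ≤ m) :
    (X : PowerSeries ℚ) ^ (n + 1) ∣
      ∏ i ∈ Finset.range m, (1 - X ^ (2 * (i + 1))) -
        ∏ i ∈ Finset.range n, (1 - X ^ (2 * (i + 1))) := by
  induction m, h using Nat.le_induction with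
  | base => simp
  | succ m hm ih =>
    rw [Finset.prod_range_succ, mul_sub, mul_one, sub_right_comm]
    exact dvd_sub ih (Dvd.dvd.mul_left (pow_dvd_pow X (by omega)) _)

open scoped PowerSeries.WithPiTopology in
theorem X_pow_dvd_tprod_sub_prod (n : ℕ) :
    (X : PowerSeries ℚ) ^ (n + 1) ∣
      ∏' i : ℕ, (1 - X ^ (2 * (i + 1))) - ∏ i ∈ Finset.range n, (1 - X ^ (2 * (i + 1))) := by
  rw [X_pow_dvd_iff]
  intro k hk
  rw [map_sub, sub_eq_zero]
  have h := ((WithPiTopology.continuous_coeff ℚ k).tendsto _).comp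
    multipliable_one_sub_X_pow_two_mul.hasProd.tendsto_prod_nat
  refine tendsto_nhds_unique h (tendsto_const_nhds.congr' ?_)
  filter_upwards [Filter.eventually_ge_atTop n] with m hm
  have := X_pow_dvd_iff.mp (X_pow_dvd_prod_sub_prod hm) k hk
  rw [map_sub, sub_eq_zero] at this
  exact this.symm

open scoped PowerSeries.WithPiTopology in
theorem coeff_diagonal_tprod (n : ℕ) :
    coeff n (diagonal (∏' i : ℕ, (1 - X ^ (2 * (i + 1))))) =
      coeff n (∏ i : Fin n, ∑ c : Fin (2 * ((i : ℕ) + 1)), (X : PowerSeries ℚ) ^ (c : ℕ)) := by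
  have h1 : ∀ N : ℕ, ∑ c : Fin N, (X : PowerSeries ℚ) ^ (c : ℕ) =
      (1 - X ^ N) * PowerSeries.mk 1 := by
    intro N
    rw [Fin.sum_univ_eq_sum_range (fun c => (X : PowerSeries ℚ) ^ c)]
    linear_combination PowerSeries.mk 1 * geom_sum_mul_neg (X : PowerSeries ℚ) N -
      (∑ c ∈ Finset.range N, (X : PowerSeries ℚ) ^ c) * mk_one_mul_one_sub_eq_one ℚ
  simp_rw [h1]
  rw [Finset.prod_mul_distrib, Finset.prod_const, Finset.card_univ, Fintype.card_fin, diagonal,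
    coeff_mk, Fin.prod_univ_eq_prod_range (fun i => (1 : PowerSeries ℚ) - X ^ (2 * (i + 1))),
    ← sub_eq_zero, ← map_sub, ← sub_mul]
  exact X_pow_dvd_iff.mp ((X_pow_dvd_tprod_sub_prod n).mul_right _) n n.lt_succ_self

/-! ### Signed permutations and their inversion codes -/

theorem apply_neg {n : ℕ} (π : hyperoctahedralGroup n) (z : SignedInterval n) :
    π.1 (-z) = -π.1 z := π.2 z

theorem eq_position_or_eq_neg_position {n : ℕ} (z : SignedInterval n) :
    ∃ p : Fin n, z = position p ∨ z = -position p := by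
  obtain ⟨z, hz, hn⟩ := z
  rw [Int.abs_eq_natAbs] at hn
  refine ⟨⟨z.natAbs - 1, by omega⟩, ?_⟩
  rcases lt_or_gt_of_ne hz with h | h
  · right
    apply Subtype.ext
    change z = -(((z.natAbs - 1 : ℕ) : ℤ) + 1)
    omega
  · left
    apply Subtype.ext
    change z = ((z.natAbs - 1 : ℕ) : ℤ) + 1
    omega

theorem neg_val {n : ℕ} (z : SignedInterval n) : (-z).1 = -z.1 := rfl

theorem absEntry_injective {n : ℕ} (π : hyperoctahedralGroup n) :
    Function.Injective (absEntry π) := by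
  intro p q h
  rcases Int.natAbs_eq_natAbs_iff.mp h with h | h
  · have := congrArg Subtype.val (π.1.injective (Subtype.ext h))
    change (p : ℤ) + 1 = (q : ℤ) + 1 at this
    exact Fin.ext (by omega)
  · rw [← neg_val, ← apply_neg] at h
    have := congrArg Subtype.val (π.1.injective (Subtype.ext h))
    change (p : ℤ) + 1 = -((q : ℤ) + 1) at this
    omega

theorem image_absEntry {n : ℕ} (π : hyperoctahedralGroup n) :
    Finset.univ.image (absEntry π) = Finset.Icc 1 n := by
  refine Finset.eq_of_subset_of_card_le ?_ ?_
  · intro v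
    simp only [Finset.mem_image, Finset.mem_univ, true_and, Finset.mem_Icc]
    rintro ⟨p, rfl⟩
    have := (π.1 (position p)).2
    rw [Int.abs_eq_natAbs] at this
    rw [absEntry]
    omega
  · rw [Finset.card_image_of_injective _ (absEntry_injective π)]
    simp

/-- The count now depends only on σ_p and the values at later positions, so the code can be decoded
from right to left. -/
theorem greaterBefore_eq_card {n : ℕ} (π : hyperoctahedralGroup n) (p : Fin n) :
    greaterBefore π p = (((Finset.Icc 1 n) \ (Finset.Ioi p).image (absEntry π)).filter
      fun v => absEntry π p < v).card := by
  rw [greaterBefore, ← Finset.card_image_of_injective _ (absEntry_injective π),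
    ← image_absEntry π]
  congr 1
  ext v
  simp only [Finset.mem_image, Finset.mem_filter, Finset.mem_univ, true_and, Finset.mem_sdiff,
    Finset.mem_Ioi]
  constructor
  · rintro ⟨j, ⟨hj, hlt⟩, rfl⟩
    refine ⟨⟨⟨j, rfl⟩, ?_⟩, hlt⟩
    rintro ⟨i, hi, he⟩
    exact absurd (absEntry_injective π he) (hj.trans hi).ne'
  · rintro ⟨⟨⟨j, rfl⟩, hj⟩, hlt⟩
    refine ⟨j, ⟨?_, hlt⟩, rfl⟩
    rcases lt_trichotomy j p with h | h | h
    · exact h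
    · exact absurd hlt (by rw [h]; exact lt_irrefl _)
    · exact absurd ⟨j, h, rfl⟩ hj

theorem card_filter_gt_lt {S : Finset ℕ} {a b : ℕ} (hb : b ∈ S) (h : a < b) :
    (S.filter fun v => b < v).card < (S.filter fun v => a < v).card := by
  refine Finset.card_lt_card (Finset.ssubset_iff_of_subset ?_ |>.mpr ⟨b, ?_, ?_⟩)
  · intro v
    simp only [Finset.mem_filter]
    exact fun ⟨h1, h2⟩ => ⟨h1, h.trans h2⟩
  · simp [hb, h]
  · simp

theorem absEntry_mem_sdiff {n : ℕ} (π : hyperoctahedralGroup n) (p : Fin n) :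
    absEntry π p ∈ (Finset.Icc 1 n) \ (Finset.Ioi p).image (absEntry π) := by
  rw [← image_absEntry π]
  simp only [Finset.mem_sdiff, Finset.mem_image, Finset.mem_univ, true_and, Finset.mem_Ioi]
  refine ⟨⟨p, rfl⟩, ?_⟩
  rintro ⟨i, hi, he⟩
  exact hi.ne' (absEntry_injective π he)

/-- A permutation is determined by its Lehmer code. -/
theorem absEntry_eq_of_greaterBefore_eq {n : ℕ} {π τ : hyperoctahedralGroup n}
    (h : greaterBefore π = greaterBefore τ) (p : Fin n) : absEntry π p = absEntry τ p := by
  induction p using WellFoundedGT.induction with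
  | ind p ih =>
    have hS : (Finset.Ioi p).image (absEntry π) = (Finset.Ioi p).image (absEntry τ) :=
      Finset.image_congr fun q hq => ih q (by simpa using hq)
    have hπ := absEntry_mem_sdiff π p
    have hτ := absEntry_mem_sdiff τ p
    have hp := congrFun h p
    rw [greaterBefore_eq_card, greaterBefore_eq_card] at hp
    rw [hS] at hp hπ
    -- Among the remaining values, distinct ones have different numbers of larger ones.
    rcases lt_trichotomy (absEntry π p) (absEntry τ p) with hlt | he | hlt
    · exact absurd hp (card_filter_gt_lt hτ hlt).ne'
    · exact he
    · exact absurd hp (card_filter_gt_lt hπ hlt).ne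

/-- The number of inversions of `π` read off at the position `p`. -/
theorem inversionsAt_rev {n : ℕ} (π : hyperoctahedralGroup n) (p : Fin n) :
    inversionsAt π p.rev = if IsNegative π p then 1 + 2 * smallerBefore π p + greaterBefore π p
      else greaterBefore π p := by
  rw [inversionsAt, Fin.rev_rev]

theorem greaterBefore_add_smallerBefore {n : ℕ} (π : hyperoctahedralGroup n) (p : Fin n) :
    greaterBefore π p + smallerBefore π p = p := by
  rw [greaterBefore, smallerBefore, ← Finset.card_union_of_disjoint, ← Fin.card_Iio p]
  · congr 1
    ext j
    have : j < p → absEntry π j ≠ absEntry π p := fun hj he => hj.ne (absEntry_injective π he)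
    simp only [Finset.mem_union, Finset.mem_filter, Finset.mem_univ, true_and, Finset.mem_Iio]
    omega
  · rw [Finset.disjoint_left]
    intro j
    simp only [Finset.mem_filter, Finset.mem_univ, true_and]
    omega

/-- The numbers of inversions of a signed permutation, indexed by position. -/
def inversionCode {n : ℕ} (π : hyperoctahedralGroup n) (p : Fin n) : Fin (2 * ((p : ℕ) + 1)) :=
  ⟨inversionsAt π p.rev, by
    have := greaterBefore_add_smallerBefore π p
    rw [inversionsAt_rev]
    split_ifs <;> omega⟩

/-- With g larger and p - g smaller earlier entries, the code is g ≤ p for a positive entry and 2p +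
1 - g ≥ p + 1 for a negative one, so it determines both the sign and g. -/
theorem inversionCode_injective (n : ℕ) :
    Function.Injective (inversionCode : hyperoctahedralGroup n → _) := by
  intro π τ h
  have hp : ∀ p, greaterBefore π p = greaterBefore τ p ∧ (IsNegative π p ↔ IsNegative τ p) := by
    intro p
    have h1 := congrArg Fin.val (congrFun h p)
    change inversionsAt π p.rev = inversionsAt τ p.rev at h1
    rw [inversionsAt_rev, inversionsAt_rev] at h1
    have h2 := greaterBefore_add_smallerBefore π p
    have h3 := greaterBefore_add_smallerBefore τ p
    split_ifs at h1 with h4 h5 h5 <;> simp only [h4, h5, iff_true, iff_false, not_true,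
      and_true, and_false] <;> omega
  have habs := absEntry_eq_of_greaterBefore_eq (funext fun p => (hp p).1)
  have hpos : ∀ p, π.1 (position p) = τ.1 (position p) := by
    intro p
    have h1 := habs p
    have h2 := (hp p).2
    rw [IsNegative, IsNegative] at h2
    rw [absEntry, absEntry] at h1
    exact Subtype.ext (by omega)
  refine Subtype.ext (Equiv.ext fun z => ?_)
  obtain ⟨p, rfl | rfl⟩ := eq_position_or_eq_neg_position z
  · exact hpos p
  · rw [apply_neg, apply_neg, hpos]

theorem sum_inversionCode {n : ℕ} (π : hyperoctahedralGroup n) :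
    ∑ p, (inversionCode π p : ℕ) = invB π :=
  Equiv.sum_comp Fin.revPerm (inversionsAt π)

/-! ### Surjectivity of the code by counting -/

/-- Elements of `⟨n⟩` as pairs of an absolute value and a sign. -/
def signedPosition {n : ℕ} (x : Fin n × ℤˣ) : SignedInterval n :=
  if x.2 = 1 then position x.1 else -position x.1

theorem neg_signedPosition {n : ℕ} (p : Fin n) (u : ℤˣ) :
    -signedPosition (p, u) = signedPosition (p, -u) := by
  rcases Int.units_eq_one_or u with rfl | rfl
  · simp [signedPosition]
  · apply Subtype.ext
    simp [signedPosition, neg_val]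

theorem signedPosition_bijective (n : ℕ) :
    Function.Bijective (signedPosition : Fin n × ℤˣ → SignedInterval n) := by
  constructor
  · rintro ⟨p, u⟩ ⟨q, v⟩ h
    have h := congrArg Subtype.val h
    have hpos : ∀ r : Fin n, (position r).1 = (r : ℤ) + 1 := fun _ => rfl
    rcases Int.units_eq_one_or u with rfl | rfl <;> rcases Int.units_eq_one_or v with rfl | rfl <;>
      simp [signedPosition, neg_val, hpos, Fin.ext_iff] at h ⊢ <;> omega
  · intro z
    obtain ⟨p, rfl | rfl⟩ := eq_position_or_eq_neg_position z
    · exact ⟨(p, 1), by simp [signedPosition]⟩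
    · exact ⟨(p, -1), by simp [signedPosition]⟩

/-- The signed permutation with given absolute values and signs. -/
noncomputable def ofPermSigns {n : ℕ} (x : Equiv.Perm (Fin n) × (Fin n → ℤˣ)) :
    hyperoctahedralGroup n :=
  let e := Equiv.ofBijective _ (signedPosition_bijective n)
  ⟨e.permCongr (Equiv.prodShear x.1 fun p => Equiv.mulRight (x.2 p)), by
    intro z
    obtain ⟨⟨p, u⟩, rfl⟩ := e.surjective z
    change e.permCongr _ (-signedPosition (p, u)) = _
    rw [neg_signedPosition]
    change e.permCongr _ (e _) = _
    rw [Equiv.permCongr_apply, Equiv.permCongr_apply, Equiv.symm_apply_apply,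
      Equiv.symm_apply_apply]
    change signedPosition _ = -signedPosition _
    simp [neg_signedPosition]⟩

theorem ofPermSigns_position {n : ℕ} (x : Equiv.Perm (Fin n) × (Fin n → ℤˣ)) (p : Fin n) :
    (ofPermSigns x).1 (position p) = signedPosition (x.1 p, x.2 p) := by
  have h : position p = Equiv.ofBijective _ (signedPosition_bijective n) (p, 1) := by
    simp [signedPosition]
  rw [ofPermSigns, h]
  simp

theorem ofPermSigns_injective (n : ℕ) :
    Function.Injective (ofPermSigns : Equiv.Perm (Fin n) × (Fin n → ℤˣ) → _) := by
  intro x y h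
  have hp : ∀ p, (x.1 p, x.2 p) = (y.1 p, y.2 p) := fun p =>
    (signedPosition_bijective n).injective (by
      rw [← ofPermSigns_position, ← ofPermSigns_position, h])
  exact Prod.ext (Equiv.ext fun p => congrArg Prod.fst (hp p))
    (funext fun p => congrArg Prod.snd (hp p))

/-- No inverse is built: the code is injective into a set of ∏ 2i = 2^n n! elements, and
`ofPermSigns` supplies at least that many signed permutations. -/
theorem inversionCode_bijective (n : ℕ) :
    Function.Bijective (inversionCode : hyperoctahedralGroup n → _) := by
  have hinj := inversionCode_injective n
  have : Finite (hyperoctahedralGroup n) := Finite.of_injective _ hinj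
  refine hinj.bijective_of_nat_card_le ?_
  refine le_trans (le_of_eq ?_) (Nat.card_le_card_of_injective _ (ofPermSigns_injective n))
  simp only [Nat.card_eq_fintype_card, Fintype.card_pi, Fintype.card_fin, Fintype.card_prod,
    Fintype.card_perm, Fintype.card_units_int, Finset.prod_const, Finset.card_univ,
    Finset.prod_mul_distrib]
  rw [Fin.prod_univ_eq_prod_range (fun i => i + 1), Finset.prod_range_add_one_eq_factorial,
    mul_comm]

/-- The generating function of `inv_B` over `B_n` is `∏_{i = 1}^n (1 + x + ⋯ + x^{2i-1})`. -/
theorem coeff_prod_eq_mahonianB (n k : ℕ) :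
    coeff k (∏ i : Fin n, ∑ c : Fin (2 * ((i : ℕ) + 1)), (X : PowerSeries ℚ) ^ (c : ℕ)) =
      mahonianB n k := by
  classical
  let e := Equiv.ofBijective _ (inversionCode_bijective n)
  have : Fintype (hyperoctahedralGroup n) := Fintype.ofEquiv _ e.symm
  rw [Fintype.prod_sum, ← Equiv.sum_comp e, mahonianB, Nat.card_eq_fintype_card,
    Fintype.card_subtype, Finset.card_filter, map_sum, Nat.cast_sum]
  refine Finset.sum_congr rfl fun π _ => ?_
  rw [Finset.prod_pow_eq_pow_sum]
  change coeff k (X ^ ∑ p, (inversionCode π p : ℕ)) = _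
  rw [sum_inversionCode, coeff_X_pow]
  simp [eq_comm]

end MahonianB

theorem theorem2p3 :
    MahonianB.T 0 =
      MahonianB.L.subst (PowerSeries.X * MahonianB.catalanGF : PowerSeries ℚ) := by
  rw [MahonianB.L, mul_comm (_ * _), ← MahonianB.diagonal_eq_subst]
  ext n
  rw [MahonianB.coeff_diagonal_tprod, MahonianB.coeff_prod_eq_mahonianB, MahonianB.T,
    PowerSeries.coeff_mk, Nat.cast_zero, sub_zero]
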